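/- **Theorem (Quantum hypergraph soft covering).** Let $\mathcal V$ be a finite-dimensional complex Hilbert space, $\mathcal X$ a finite set, $p$ a probability distribution on $\mathcal X$, and $(E_x)_{x\in\mathcal X}$ Hermitian matrices on $\mathcal V$ (edges) with $E_x\succeq 0$ and $\mathrm{Tr}(E_x)\le 1$ (so in particular $0\preceq E_x\preceq \mathbf 1_{\mathcal V}$). Put $E_p=\sum_x p(x)E_x$ and, for a codebook $\mathcal C=(x_1,\dots,x_L)\in\mathcal X^L$, $E_{\mathcal C}=\frac1L\sum_{l=1}^L E_{x_l}$. Let $\varepsilon,\tau\in(0,\frac12)$, $\tau_0\in(0,\frac12-\tau)$, $\eta>0$, and assume $E_x\preceq\eta\mathbf 1_{\mathcal V}$ for all $x$ and $\mathrm{Tr}(E_p)\ge 1-\tau$. Let $\Pi_1$ be the orthogonal projector onto the sum of the eigenspaces of $E_p$ with eigenvalue $>\tau_0/\dim\mathcal V$, and write $A^{\Pi_1}=\Pi_1A\Pi_1$. With the generalized inverse square root $(E_p^{\Pi_1})^{-1/2}$ (which vanishes on the kernel), define $$D_{\max}=\max_x\ln\lambda_{\max}\big((E_p^{\Pi_1})^{-1/2}E_x^{\Pi_1}(E_p^{\Pi_1})^{-1/2}\big),\qquad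 M(x)=e^{-D_{\max}}(E_p^{\Pi_1})^{-1/2}E_x^{\Pi_1}(E_p^{\Pi_1})^{-1/2}.$$ The matrix multiplicative weight update (MMWU) algorithm, run on $\mathrm{supp}(E_p^{\Pi_1})$, chooses $x_1,\dots,x_L$ as follows: in round $l=1,\dots,L$ it sets $G(l)=\exp\big(-\varepsilon\sum_{l'<l}M(x_{l'})\big)$ (an operator on $\mathrm{supp}(E_p^{\Pi_1})$, with $G(1)$ the identity there) and $F(l)=G(l)/\mathrm{Tr}(G(l))$, and it takes for $x_l$ any maximizer of $x\mapsto\mathrm{Tr}(F(l)M(x))$ over $\mathcal X$. Then for every integer $L\ge1$ with $$L\ \ge\ \frac{\eta\,\dim(\mathcal V)\,\ln\dim(\mathcal V)}{\varepsilon^2\tau_0}$$ the algorithm yields a codebook of size $L$, and every codebook $\mathcal C=(x_1,\dots,x_L)$ obtained by it (however ties are broken) satisfies $$d_{\mathrm{tr}}(E_p,E_{\mathcal C})=\tfrac12\|E_p-E_{\mathcal C}\|_1\ \le\ 3\varepsilon+3\tau+\tfrac72\tau_0+\sqrt{2\varepsilon+\tau+\tau_0}.$$ -/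

import Mathlib

open scoped Matrix ComplexOrder

noncomputable section

namespace SoftCovering

variable {ι X : Type*} [Fintype ι] [DecidableEq ι]

/-- Trace norm `‖A‖₁ = Tr √(A* A)`. -/
def traceNorm (A : Matrix ι ι ℂ) : ℝ :=
  (cfc Real.sqrt (Aᴴ * A)).trace.re

/-- Trace distance `½ ‖A - B‖₁`. -/
def traceDist (A B : Matrix ι ι ℂ) : ℝ :=
  (1 / 2) * traceNorm (A - B)

/-- The `p`-average `E_p = ∑ₓ p(x) E_x`. -/
def avg [Fintype X] (p : X → ℝ) (E : X → Matrix ι ι ℂ) : Matrix ι ι ℂ :=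
  ∑ x, p x • E x

/-- The uniform average `E_C = (1/L) ∑ₗ E_{x_l}` over a codebook `x_1, …, x_L`. -/
def codebookAvg {L : ℕ} (E : X → Matrix ι ι ℂ) (x : Fin L → X) : Matrix ι ι ℂ :=
  (1 / (L : ℝ)) • ∑ l, E (x l)

/-- The spectral projector `{A > r}` of a Hermitian matrix `A`: the sum of the eigenprojectors
of `A` that belong to eigenvalues larger than `r`. -/
def projGT (A : Matrix ι ι ℂ) (r : ℝ) : Matrix ι ι ℂ :=
  cfc (fun t : ℝ => if r < t then (1 : ℝ) else 0) A

/-- The generalized inverse square root `A^{-1/2}` of a positive semidefinite matrix `A`: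
an eigenvalue `t > 0` is sent to `1/√t`, and the eigenvalue `0` to `0` (as `(√0)⁻¹ = 0`). -/
def invSqrt (A : Matrix ι ι ℂ) : Matrix ι ι ℂ :=
  cfc (fun t : ℝ => (Real.sqrt t)⁻¹) A

/-- The largest eigenvalue of a Hermitian matrix. -/
def lambdaMax (A : Matrix ι ι ℂ) : ℝ :=
  sSup (spectrum ℝ A)

/-- `D_max = maxₓ ln λ_max(A^{-1/2} E_x A^{-1/2})`; the logarithm is taken after the maximum, which
is the same number, with `ln 0` read as `-∞` inside the maximum. -/
def dMax (A : Matrix ι ι ℂ) (E : X → Matrix ι ι ℂ) : ℝ :=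
  Real.log (⨆ x, lambdaMax (invSqrt A * E x * invSqrt A))

/-- The cost matrix `M(x) = A^{-1/2} E_x A^{-1/2} e^{-D_max}`. -/
def costMatrix (A : Matrix ι ι ℂ) (E : X → Matrix ι ι ℂ) (x : X) : Matrix ι ι ℂ :=
  Real.exp (-dMax A E) • (invSqrt A * E x * invSqrt A)

/-- The weight matrix of the matrix multiplicative weight update algorithm run on the range of the
projector `P`, `G(l) = exp(-ε ∑_{l' < l} M(x_{l'}))`, where the exponential is the one of operators
on the range of `P`. Such operators are seen as operators on the whole space that vanish on the
kernel of `P`, hence the factor `P`; in the first round `G = P`. -/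
def weight {L : ℕ} (P : Matrix ι ι ℂ) (ε : ℝ) (M : X → Matrix ι ι ℂ) (x : Fin L → X) (l : Fin L) :
    Matrix ι ι ℂ :=
  P * NormedSpace.exp (-(ε • ∑ l' ∈ Finset.Iio l, M (x l')))

/-- The mixed state `F(l) = G(l) / Tr G(l)`. -/
def mixedState {L : ℕ} (P : Matrix ι ι ℂ) (ε : ℝ) (M : X → Matrix ι ι ℂ) (x : Fin L → X)
    (l : Fin L) : Matrix ι ι ℂ :=
  (weight P ε M x l).trace⁻¹ • weight P ε M x l

/-- `x_1, …, x_L` is a possible outcome of `L` rounds of the algorithm on the range of `P`: in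
each round `l` the pure strategy `x_l` maximizes `Tr (F(l) M(x))` (ties are broken arbitrarily). -/
def IsMMWURun {L : ℕ} (P : Matrix ι ι ℂ) (ε : ℝ) (M : X → Matrix ι ι ℂ) (x : Fin L → X) : Prop :=
  ∀ l : Fin L, ∀ y : X,
    (mixedState P ε M x l * M y).trace.re ≤ (mixedState P ε M x l * M (x l)).trace.re

/-- The projector `Π₁` onto the eigenspaces of `E_p` with eigenvalue larger than `τ₀ / dim V`. -/
def largeProj [Fintype X] (p : X → ℝ) (E : X → Matrix ι ι ℂ) (τ₀ : ℝ) : Matrix ι ι ℂ :=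
  projGT (avg p E) (τ₀ / Fintype.card ι)

/-- The pinching map `A ↦ Π A Π`. -/
def pinch (P A : Matrix ι ι ℂ) : Matrix ι ι ℂ := P * A * P

/-- `x_1, …, x_L` is a codebook obtained by the algorithm from the pinched edges
`Π₁ E_x Π₁`, with the cost matrices taken relative to `Π₁ E_p Π₁` and the algorithm run on the
support of `Π₁ E_p Π₁`. -/
def IsMMWUCodebook [Fintype X] {L : ℕ} (p : X → ℝ) (E : X → Matrix ι ι ℂ) (ε τ₀ : ℝ)
    (x : Fin L → X) : Prop :=
  let P₁ := largeProj p E τ₀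
  let A := pinch P₁ (avg p E)
  IsMMWURun (projGT A 0) ε (costMatrix A fun y => pinch P₁ (E y)) x

end SoftCovering

end

open SoftCovering

open scoped Matrix ComplexOrder

noncomputable section

/-! Write `ρ = E_p`, `P = Π₁`, `Λ = e^{D_max}`. Eigenvalues of `ρ` on the range of `P` exceed `τ₀ /
dim V`, so `Λ ≤ η dim V / τ₀`, and the `p`-average of the costs `M(x)` is exactly `Λ⁻¹ P`. The
algorithm is controlled by the potential `Tr P exp(-ε ∑ M(x_l))`, which starts at `Tr P ≤ dim V`.
Golden-Thompson and the chord bound on `exp(-ε M)` control one round. Since the chosen `x_l` does at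
least as well as the `p`-average, the potential shrinks by a factor `exp(-(1 - e^{-ε}) / Λ)` or
better. After `L` rounds its size forces `∑ M(x_l) ≥ (1 - 2ε) (L/Λ) P`
(`IsMMWURun.posSemidef_sum_sub`). Conjugating by the square root of `PρP` gives `P E_C P ≥ (1 - 2ε)
PρP` (`posSemidef_pinch_codebookAvg_sub`). This one-sided domination suffices because both traces
are at most `1` and `Tr PρP ≥ 1 - τ - τ₀`: `P E_C P` is trace-close to `PρP`, and `E_C` has little
weight outside `P`, so pinching hardly disturbs it (`re_trace_mul_pinch_sub_le`,
`traceNorm_sub_le`). -/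

namespace SoftCovering

open Filter Topology

/-! ### The Lie-Trotter product formula. -/

section Trotter

variable {𝔸 : Type*} [NormedRing 𝔸]

theorem norm_pow_sub_pow_le [NormOneClass 𝔸] {x y : 𝔸} {c : ℝ} (hc : 1 ≤ c) (hx : ‖x‖ ≤ c) (hy : ‖y‖ ≤ c) (n : ℕ) :
    ‖x ^ n - y ^ n‖ ≤ n * c ^ n * ‖x - y‖ := by
  have hc0 : 0 ≤ c := zero_le_one.trans hc
  induction n with
  | zero => simp
  | succ n ih =>
    have h : x ^ (n + 1) - y ^ (n + 1) = x ^ n * (x - y) + (x ^ n - y ^ n) * y := by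
      rw [pow_succ, pow_succ]; noncomm_ring
    have h1 : ‖x ^ n * (x - y)‖ ≤ c ^ n * ‖x - y‖ :=
      (norm_mul_le _ _).trans (by
        gcongr
        exact (norm_pow_le _ _).trans (pow_le_pow_left₀ (norm_nonneg _) hx n))
    have h2 : ‖(x ^ n - y ^ n) * y‖ ≤ n * c ^ n * ‖x - y‖ * c :=
      (norm_mul_le _ _).trans (by gcongr)
    have h3 : c ^ n * ‖x - y‖ ≤ c ^ n * ‖x - y‖ * c :=
      le_mul_of_one_le_right (by positivity) hc
    rw [h]
    calc ‖x ^ n * (x - y) + (x ^ n - y ^ n) * y‖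
        ≤ c ^ n * ‖x - y‖ * c + n * c ^ n * ‖x - y‖ * c :=
          (norm_add_le _ _).trans (add_le_add (h1.trans h3) h2)
      _ = ((n + 1 : ℕ) : ℝ) * c ^ (n + 1) * ‖x - y‖ := by push_cast; ring

variable [NormedAlgebra ℝ 𝔸]

theorem tendsto_natCast_smul_sub {f : ℝ → 𝔸} {z : 𝔸} (hf : HasDerivAt f z 0) :
    Tendsto (fun n : ℕ => (n : ℝ) • (f ((n : ℝ)⁻¹) - f 0)) atTop (𝓝 z) := by
  have h := hf.tendsto_slope_zero
  have hn : Tendsto (fun n : ℕ => ((n : ℝ)⁻¹)) atTop (𝓝[≠] (0 : ℝ)) := by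
    rw [tendsto_nhdsWithin_iff]
    refine ⟨tendsto_inv_atTop_nhds_zero_nat, ?_⟩
    filter_upwards [eventually_gt_atTop 0] with n hn
    simpa using hn.ne'
  simpa [Function.comp_def] using h.comp hn

/-- The exponential form keeps the `n`-th powers bounded by the constant `exp(‖z‖ + 1)`. -/
theorem eventually_norm_le_exp [NormOneClass 𝔸] {f : ℝ → 𝔸} {z : 𝔸} (hf : HasDerivAt f z 0) (h0 : f 0 = 1) :
    ∀ᶠ n : ℕ in atTop, ‖f ((n : ℝ)⁻¹)‖ ≤ Real.exp ((‖z‖ + 1) / n) := by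
  filter_upwards [(tendsto_natCast_smul_sub hf).norm.eventually_le_const (lt_add_one ‖z‖),
    eventually_gt_atTop 0] with n hn hn0
  have hn0' : (0 : ℝ) < n := by exact_mod_cast hn0
  rw [norm_smul, Real.norm_natCast, h0, mul_comm, ← le_div_iff₀ hn0'] at hn
  calc ‖f ((n : ℝ)⁻¹)‖ = ‖(f ((n : ℝ)⁻¹) - 1) + 1‖ := by rw [sub_add_cancel]
    _ ≤ (‖z‖ + 1) / n + 1 := (norm_add_le _ _).trans (by rw [norm_one]; gcongr)
    _ ≤ _ := Real.add_one_le_exp _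

/-- Two curves through `1` with the same velocity there have asymptotically equal `n`-th powers
at time `1 / n`. -/
theorem tendsto_pow_sub_pow [NormOneClass 𝔸] {f g : ℝ → 𝔸} {z : 𝔸} (hf : HasDerivAt f z 0)
    (hg : HasDerivAt g z 0) (hf0 : f 0 = 1) (hg0 : g 0 = 1) :
    Tendsto (fun n : ℕ => f ((n : ℝ)⁻¹) ^ n - g ((n : ℝ)⁻¹) ^ n) atTop (𝓝 0) := by
  have hd := (tendsto_natCast_smul_sub (hf.sub hg)).norm.const_mul (Real.exp (‖z‖ + 1))
  simp only [sub_self, norm_zero, mul_zero, Pi.sub_apply, hf0, hg0, sub_zero] at hd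
  refine squeeze_zero_norm' ?_ hd
  filter_upwards [eventually_norm_le_exp hf hf0, eventually_norm_le_exp hg hg0,
    eventually_gt_atTop 0] with n h1 h2 hn0
  have hn0' : (n : ℝ) ≠ 0 := by exact_mod_cast hn0.ne'
  -- With `c = exp((‖z‖ + 1) / n)` the factor `c ^ n` is constant, and `n ‖f - g‖` tends to `0`
  -- because the velocities cancel.
  refine (norm_pow_sub_pow_le (Real.one_le_exp (by positivity)) h1 h2 n).trans_eq ?_
  rw [← Real.exp_nat_mul, mul_div_cancel₀ _ hn0', norm_smul, Real.norm_natCast]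
  ring

/-- The Lie-Trotter product formula. -/
theorem tendsto_exp_mul_exp_pow [NormOneClass 𝔸] [CompleteSpace 𝔸] (a b : 𝔸) :
    Tendsto (fun n : ℕ => (NormedSpace.exp ((n : ℝ)⁻¹ • a) * NormedSpace.exp ((n : ℝ)⁻¹ • b)) ^ n)
      atTop (𝓝 (NormedSpace.exp (a + b))) := by
  have hd (c : 𝔸) : HasDerivAt (fun t : ℝ => NormedSpace.exp (t • c)) c 0 := by
    simpa using hasDerivAt_exp_smul_const (𝕂 := ℝ) c 0
  have hab : HasDerivAt (fun t : ℝ => NormedSpace.exp (t • a) * NormedSpace.exp (t • b))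
      (a + b) 0 := by
    have h := (hd a).mul (hd b)
    simp only [zero_smul, NormedSpace.exp_zero, mul_one, one_mul] at h
    exact h
  have h := tendsto_pow_sub_pow hab (hd (a + b)) (by simp) (by simp)
  rw [← tendsto_sub_nhds_zero_iff]
  refine h.congr' ?_
  filter_upwards [eventually_gt_atTop 0] with n hn
  have hn0' : (n : ℝ) ≠ 0 := by exact_mod_cast hn.ne'
  let : NormedAlgebra ℚ 𝔸 := NormedAlgebra.restrictScalars ℚ ℝ 𝔸
  rw [← NormedSpace.exp_nsmul, ← Nat.cast_smul_eq_nsmul ℝ, smul_smul, mul_inv_cancel₀ hn0', one_smul]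

end Trotter

/-! ### Trace inequalities for powers, and Golden-Thompson. -/

section GoldenThompson

variable {ι : Type*} [Fintype ι]

theorem norm_trace_mul_conjTranspose_self (A : Matrix ι ι ℂ) :
    ‖(A * Aᴴ).trace‖ = ∑ q : ι × ι, ‖A q.1 q.2‖ ^ 2 := by
  have h : (A * Aᴴ).trace = ((∑ q : ι × ι, ‖A q.1 q.2‖ ^ 2 : ℝ) : ℂ) := by
    simp [Matrix.trace, Matrix.mul_apply, Fintype.sum_prod_type, Complex.mul_conj,
      Complex.normSq_eq_norm_sq]
  rw [h, Complex.norm_real, Real.norm_of_nonneg (by positivity)]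

/-- The Cauchy-Schwarz inequality for the Hilbert-Schmidt inner product. -/
theorem norm_trace_mul_sq_le (A B : Matrix ι ι ℂ) :
    ‖(A * B).trace‖ ^ 2 ≤ ‖(A * Aᴴ).trace‖ * ‖(B * Bᴴ).trace‖ := by
  have h : ‖(A * B).trace‖ ≤ ∑ q : ι × ι, ‖A q.1 q.2‖ * ‖B q.2 q.1‖ := by
    simp only [Matrix.trace, Matrix.mul_apply, Matrix.diag_apply]
    rw [← Fintype.sum_prod_type']
    exact (norm_sum_le _ _).trans (by simp)
  have hB : ‖(B * Bᴴ).trace‖ = ∑ q : ι × ι, ‖B q.2 q.1‖ ^ 2 := by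
    rw [norm_trace_mul_conjTranspose_self]
    exact (Equiv.sum_comp (Equiv.prodComm ι ι) fun q => ‖B q.1 q.2‖ ^ 2).symm
  rw [norm_trace_mul_conjTranspose_self, hB]
  exact (pow_le_pow_left₀ (norm_nonneg _) h 2).trans (Finset.sum_mul_sq_le_sq_mul_sq _ _ _)

variable [DecidableEq ι]

theorem trace_mul_pow_comm (A B : Matrix ι ι ℂ) (n : ℕ) :
    ((A * B) ^ n).trace = ((B * A) ^ n).trace := by
  cases n with
  | zero => simp
  | succ n =>
    have h : (A * B) ^ (n + 1) = A * ((B * A) ^ n * B) := by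
      induction n with
      | zero => simp
      | succ n ih => rw [pow_succ, ih, pow_succ (B * A) n]; simp only [mul_assoc]
    rw [h, Matrix.trace_mul_comm, pow_succ]
    simp only [mul_assoc]

/-- The power-of-two case of `|Tr X^(2m)| ≤ Tr (X X*)^m`, jointly with
`|Tr (A B)^m| ≤ |Tr (A^m B^m)|` for Hermitian `A` and `B`. -/
theorem norm_trace_pow_two_pow_le (k : ℕ) :
    (∀ X : Matrix ι ι ℂ, ‖(X ^ 2 ^ (k + 1)).trace‖ ≤ ‖((X * Xᴴ) ^ 2 ^ k).trace‖) ∧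
      ∀ A B : Matrix ι ι ℂ, A.IsHermitian → B.IsHermitian →
        ‖((A * B) ^ 2 ^ k).trace‖ ≤ ‖(A ^ 2 ^ k * B ^ 2 ^ k).trace‖ := by
  induction k with
  | zero =>
    refine ⟨fun X => ?_, fun A B _ _ => by simp⟩
    have h := norm_trace_mul_sq_le X X
    rw [← sq, ← sq] at h
    simpa using (abs_le_of_sq_le_sq' h (norm_nonneg _)).2
  | succ k ih =>
    obtain ⟨iha, ihb⟩ := ih
    refine ⟨fun X => ?_, fun A B hA hB => ?_⟩
    -- Cyclicity turns `X² (X²)*` into the product of the Hermitian matrices `X X*` and `X* X`. The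
    -- second claim separates their powers, and Cauchy-Schwarz finishes, since these powers have
    -- equal traces.
    · have h1 := iha (X ^ 2)
      rw [← pow_mul, ← pow_succ'] at h1
      have e : X ^ 2 * (X ^ 2)ᴴ = X * (X * Xᴴ * Xᴴ) := by
        rw [Matrix.conjTranspose_pow, sq, sq]; simp only [mul_assoc]
      rw [e, trace_mul_pow_comm, mul_assoc] at h1
      have h2 := ihb (X * Xᴴ) (Xᴴ * X) (Matrix.isHermitian_mul_conjTranspose_self X)
        (Matrix.isHermitian_conjTranspose_mul_self X)
      refine h1.trans (h2.trans ?_)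
      have h3 := norm_trace_mul_sq_le ((X * Xᴴ) ^ 2 ^ k) ((Xᴴ * X) ^ 2 ^ k)
      rw [Matrix.conjTranspose_pow, Matrix.conjTranspose_pow,
        (Matrix.isHermitian_mul_conjTranspose_self X).eq,
        (Matrix.isHermitian_conjTranspose_mul_self X).eq, ← sq, ← sq, ← pow_mul, ← pow_mul,
        ← pow_succ, trace_mul_pow_comm Xᴴ X, ← sq] at h3
      exact abs_le_of_sq_le_sq' h3 (norm_nonneg _) |>.2
    -- Here `(A B)(A B)* = A B² A`, which cyclicity turns into `A² B²`, at half the exponent.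
    · have h1 := iha (A * B)
      have e : A * B * (A * B)ᴴ = A * (B ^ 2 * A) := by
        rw [Matrix.conjTranspose_mul, hA.eq, hB.eq, sq]; simp only [mul_assoc]
      rw [e, trace_mul_pow_comm A (B ^ 2 * A), mul_assoc, ← sq, trace_mul_pow_comm (B ^ 2)] at h1
      refine h1.trans ((ihb _ _ (hA.pow 2) (hB.pow 2)).trans_eq ?_)
      rw [← pow_mul, ← pow_mul, ← pow_succ']

open scoped Matrix.Norms.L2Operator in
/-- The Golden-Thompson inequality. -/
theorem norm_trace_exp_add_le {H K : Matrix ι ι ℂ} (hH : H.IsHermitian) (hK : K.IsHermitian) :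
    ‖(NormedSpace.exp (H + K)).trace‖ ≤ ‖(NormedSpace.exp H * NormedSpace.exp K).trace‖ := by
  cases isEmpty_or_nonempty ι
  · simp [Matrix.trace]
  -- Only the subsequence `n = 2 ^ k` is used, as the power inequality is available there.
  have ht := (tendsto_exp_mul_exp_pow H K).comp (tendsto_pow_atTop_atTop_of_one_lt (one_lt_two (α := ℕ)))
  have htr : Continuous fun A : Matrix ι ι ℂ => ‖A.trace‖ :=
    (Continuous.matrix_trace continuous_id).norm
  refine le_of_tendsto ((htr.tendsto _).comp ht) (Eventually.of_forall fun k => ?_)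
  have hherm (c : ℝ) {A : Matrix ι ι ℂ} (hA : A.IsHermitian) :
      (NormedSpace.exp (c • A)).IsHermitian := by
    refine Matrix.IsHermitian.exp ?_
    rw [Matrix.IsHermitian, Matrix.conjTranspose_smul, hA.eq, star_trivial]
  have hpow (A : Matrix ι ι ℂ) :
      NormedSpace.exp ((((2 ^ k : ℕ) : ℝ))⁻¹ • A) ^ 2 ^ k = NormedSpace.exp A := by
    rw [← Matrix.exp_nsmul, ← Nat.cast_smul_eq_nsmul ℝ, smul_smul, mul_inv_cancel₀ (by positivity),
      one_smul]
  have h := (norm_trace_pow_two_pow_le k).2 _ _ (hherm (((2 ^ k : ℕ) : ℝ))⁻¹ hH)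
    (hherm (((2 ^ k : ℕ) : ℝ))⁻¹ hK)
  rwa [hpow, hpow] at h

end GoldenThompson

/-! ### Positive semidefinite matrices and their functional calculus. -/

section PosSemidef

variable {ι : Type*} [Fintype ι]

open scoped MatrixOrder in
theorem exists_eq_conjTranspose_mul_self {A : Matrix ι ι ℂ} (hA : A.PosSemidef) :
    ∃ R : Matrix ι ι ℂ, A = Rᴴ * R := by
  classical
  exact CStarAlgebra.nonneg_iff_eq_star_mul_self.mp hA.nonneg

theorem trace_mul_nonneg {A B : Matrix ι ι ℂ} (hA : A.PosSemidef) (hB : B.PosSemidef) :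
    0 ≤ (A * B).trace := by
  obtain ⟨C, rfl⟩ := exists_eq_conjTranspose_mul_self hB
  rw [← mul_assoc, Matrix.trace_mul_comm, ← mul_assoc]
  exact (hA.mul_mul_conjTranspose_same C).trace_nonneg

theorem re_trace_nonneg {A : Matrix ι ι ℂ} (hA : A.PosSemidef) : 0 ≤ A.trace.re :=
  (Complex.nonneg_iff.mp hA.trace_nonneg).1

theorem re_trace_mul_nonneg {A B : Matrix ι ι ℂ} (hA : A.PosSemidef) (hB : B.PosSemidef) :
    0 ≤ (A * B).trace.re :=
  (Complex.nonneg_iff.mp (trace_mul_nonneg hA hB)).1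

theorem re_trace_real_smul (r : ℝ) (A : Matrix ι ι ℂ) : (r • A).trace.re = r * A.trace.re := by
  simp [Matrix.trace_smul]

theorem PosSemidef.sandwich {A B : Matrix ι ι ℂ} (hA : A.PosSemidef) (hB : B.IsHermitian) :
    (B * A * B).PosSemidef := by
  simpa [hB.eq] using hA.mul_mul_conjTranspose_same B

theorem posSemidef_of_isHermitian_of_idempotent {P : Matrix ι ι ℂ} (hP : P.IsHermitian)
    (hPP : P * P = P) : P.PosSemidef := by
  classical
  have h := PosSemidef.sandwich Matrix.PosSemidef.one hP
  rwa [mul_one, hPP] at h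

theorem norm_eq_re_of_nonneg {z : ℂ} (hz : 0 ≤ z) : ‖z‖ = z.re := by
  rw [← congrArg Complex.re (Complex.eq_coe_norm_of_nonneg hz) |>.trans (Complex.ofReal_re _)]

/-- A Cauchy-Schwarz inequality for the sesquilinear form given by a positive semidefinite `σ`. -/
theorem sq_norm_trace_mul_mul_le {σ : Matrix ι ι ℂ} (hσ : σ.PosSemidef) (A B : Matrix ι ι ℂ) :
    ‖(A * σ * B).trace‖ ^ 2 ≤ (A * σ * Aᴴ).trace.re * (Bᴴ * σ * B).trace.re := by
  obtain ⟨R, rfl⟩ := exists_eq_conjTranspose_mul_self hσ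
  have h := norm_trace_mul_sq_le (A * Rᴴ) (R * B)
  have h1 : A * Rᴴ * (A * Rᴴ)ᴴ = A * (Rᴴ * R) * Aᴴ := by
    simp [Matrix.conjTranspose_mul, mul_assoc]
  have h2 : (R * B * (R * B)ᴴ).trace = (Bᴴ * (Rᴴ * R) * B).trace := by
    rw [Matrix.trace_mul_comm, Matrix.conjTranspose_mul]
    simp only [mul_assoc]
  have h3 : 0 ≤ (Bᴴ * (Rᴴ * R) * B).trace := by
    simpa using (hσ.mul_mul_conjTranspose_same Bᴴ).trace_nonneg
  rw [h1, h2, norm_eq_re_of_nonneg (hσ.mul_mul_conjTranspose_same A).trace_nonneg,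
    norm_eq_re_of_nonneg h3] at h
  simpa only [mul_assoc] using h

variable [DecidableEq ι]

/-- The spectrum is finite, so even discontinuous functions such as spectral indicators obey the
functional calculus. -/
theorem continuousOn_spectrum (f : ℝ → ℝ) (A : Matrix ι ι ℂ) : ContinuousOn f (spectrum ℝ A) :=
  Matrix.finite_real_spectrum.continuousOn f

theorem cfc_mul_cfc (f g : ℝ → ℝ) (A : Matrix ι ι ℂ) :
    cfc f A * cfc g A = cfc (fun t => f t * g t) A :=
  (cfc_mul f g A (continuousOn_spectrum f A) (continuousOn_spectrum g A)).symm

theorem cfc_sub_cfc (f g : ℝ → ℝ) (A : Matrix ι ι ℂ) :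
    cfc f A - cfc g A = cfc (fun t => f t - g t) A :=
  (cfc_sub f g A (continuousOn_spectrum f A) (continuousOn_spectrum g A)).symm

theorem cfc_add_cfc (f g : ℝ → ℝ) (A : Matrix ι ι ℂ) :
    cfc f A + cfc g A = cfc (fun t => f t + g t) A :=
  (cfc_add A f g (continuousOn_spectrum f A) (continuousOn_spectrum g A)).symm

theorem smul_cfc (r : ℝ) (f : ℝ → ℝ) (A : Matrix ι ι ℂ) :
    r • cfc f A = cfc (fun t => r * f t) A := by
  rw [cfc_const_mul r f A (continuousOn_spectrum f A)]

theorem cfc_cfc (f g : ℝ → ℝ) {A : Matrix ι ι ℂ} (hA : A.IsHermitian) :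
    cfc g (cfc f A) = cfc (fun t => g (f t)) A :=
  (cfc_comp' g f A ((Matrix.finite_real_spectrum.image f).continuousOn g)
    (continuousOn_spectrum f A) hA.isSelfAdjoint).symm

theorem isHermitian_cfc (f : ℝ → ℝ) (A : Matrix ι ι ℂ) : (cfc f A).IsHermitian :=
  cfc_predicate f A

theorem one_eq_cfc {A : Matrix ι ι ℂ} (hA : A.IsHermitian) :
    (1 : Matrix ι ι ℂ) = cfc (fun _ : ℝ => (1 : ℝ)) A :=
  (cfc_const_one ℝ A hA.isSelfAdjoint).symm

theorem eq_cfc_id {A : Matrix ι ι ℂ} (hA : A.IsHermitian) : A = cfc (fun t : ℝ => t) A :=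
  (cfc_id' ℝ A hA.isSelfAdjoint).symm

open scoped MatrixOrder in
theorem posSemidef_cfc {f : ℝ → ℝ} {A : Matrix ι ι ℂ} (h : ∀ t ∈ spectrum ℝ A, 0 ≤ f t) :
    (cfc f A).PosSemidef :=
  Matrix.nonneg_iff_posSemidef.mp (cfc_nonneg h)

open scoped MatrixOrder in
theorem spectrum_nonneg {A : Matrix ι ι ℂ} (hA : A.PosSemidef) {t : ℝ} (ht : t ∈ spectrum ℝ A) :
    0 ≤ t :=
  spectrum_nonneg_of_nonneg (Matrix.nonneg_iff_posSemidef.mpr hA) ht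

theorem posSemidef_smul_one_sub_iff {A : Matrix ι ι ℂ} (hA : A.IsHermitian) {r : ℝ} :
    (r • (1 : Matrix ι ι ℂ) - A).PosSemidef ↔ ∀ t ∈ spectrum ℝ A, t ≤ r := by
  constructor
  · intro h t ht
    have : r - t ∈ spectrum ℝ (r • (1 : Matrix ι ι ℂ) - A) := by
      rw [← Algebra.algebraMap_eq_smul_one, ← spectrum.singleton_sub_eq]
      exact Set.sub_mem_sub rfl ht
    linarith [spectrum_nonneg h this]
  · intro h
    rw [one_eq_cfc hA, smul_cfc]
    nth_rw 2 [eq_cfc_id hA]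
    rw [cfc_sub_cfc]
    exact posSemidef_cfc fun t ht => by linarith [h t ht]

end PosSemidef

/-! ### Trace norm and gentle measurement. -/

section TraceNorm

variable {ι : Type*} [Fintype ι] [DecidableEq ι]

/-- The trace norm of a Hermitian matrix is attained by pairing with its sign. -/
theorem exists_traceNorm_eq_re_trace_mul {D : Matrix ι ι ℂ} (hD : D.IsHermitian) :
    ∃ S : Matrix ι ι ℂ, S.IsHermitian ∧ (1 - S).PosSemidef ∧ (1 + S).PosSemidef ∧
      (1 - S * S).PosSemidef ∧ traceNorm D = (S * D).trace.re := by
  set s : ℝ → ℝ := fun t => if 0 ≤ t then 1 else -1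
  refine ⟨cfc s D, isHermitian_cfc _ _, ?_, ?_, ?_, ?_⟩
  · rw [one_eq_cfc hD, cfc_sub_cfc]
    refine posSemidef_cfc fun t _ => ?_
    simp only [s]; split_ifs <;> norm_num
  · rw [one_eq_cfc hD, cfc_add_cfc]
    refine posSemidef_cfc fun t _ => ?_
    simp only [s]; split_ifs <;> norm_num
  · rw [one_eq_cfc hD, cfc_mul_cfc, cfc_sub_cfc]
    refine posSemidef_cfc fun t _ => ?_
    simp only [s]; split_ifs <;> norm_num
  · have h1 : Dᴴ * D = cfc (fun t : ℝ => t * t) D := by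
      rw [hD.eq]
      nth_rw 1 2 [eq_cfc_id hD]
      rw [cfc_mul_cfc]
    have h2 : cfc s D * D = cfc (fun t => s t * t) D := by
      nth_rw 2 [eq_cfc_id hD]
      rw [cfc_mul_cfc]
    rw [traceNorm, h1, cfc_cfc _ _ hD, h2]
    congr 3
    funext t
    simp only [s, Real.sqrt_mul_self_eq_abs]
    split_ifs with h
    · rw [abs_of_nonneg h, one_mul]
    · rw [abs_of_neg (not_le.mp h), neg_one_mul]

theorem re_trace_mul_le_of_posSemidef {S A : Matrix ι ι ℂ} (hS : (1 - S).PosSemidef)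
    (hA : A.PosSemidef) : (S * A).trace.re ≤ A.trace.re := by
  have h := re_trace_mul_nonneg hS hA
  rw [sub_mul, one_mul, Matrix.trace_sub, Complex.sub_re] at h
  linarith

theorem neg_re_trace_mul_le_of_posSemidef {S A : Matrix ι ι ℂ} (hS : (1 + S).PosSemidef)
    (hA : A.PosSemidef) : -(S * A).trace.re ≤ A.trace.re := by
  have h := re_trace_mul_nonneg hS hA
  rw [add_mul, one_mul, Matrix.trace_add, Complex.add_re] at h
  linarith

/-- The gentle measurement estimate, tested against a Hermitian contraction `S`. -/
theorem re_trace_mul_pinch_sub_le {σ P S : Matrix ι ι ℂ} (hσ : σ.PosSemidef) (hσ1 : σ.trace.re ≤ 1)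
    (hP : P.IsHermitian) (hPP : P * P = P) (hS : S.IsHermitian) (hS1 : (1 - S * S).PosSemidef)
    {δ : ℝ} (hδ : σ.trace.re - (P * σ * P).trace.re ≤ δ) :
    (S * (P * σ * P - σ)).trace.re ≤ 2 * √δ := by
  set Q := 1 - P with hQ
  have hQh : Q.IsHermitian := Matrix.isHermitian_one.sub hP
  have hQQ : Q * Q = Q := by rw [hQ]; rw [sub_mul, one_mul, mul_sub, mul_one, hPP]; simp
  have htrQ : (Q * σ * Q).trace.re = σ.trace.re - (P * σ * P).trace.re := by
    have h1 : (Q * σ * Q).trace = σ.trace - (P * σ * P).trace := by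
      rw [Matrix.trace_mul_comm, ← mul_assoc, hQQ, Matrix.trace_mul_comm (P * σ), ← mul_assoc, hPP,
        hQ, sub_mul, one_mul, Matrix.trace_sub]
    rw [h1, Complex.sub_re]
  have hQσ : 0 ≤ (Q * σ * Q).trace.re := re_trace_nonneg (PosSemidef.sandwich hσ hQh)
  have hSσ : (S * σ * S).trace.re ≤ 1 := by
    have h := re_trace_mul_nonneg hS1 hσ
    rw [sub_mul, one_mul, Matrix.trace_sub, Complex.sub_re, mul_assoc, Matrix.trace_mul_comm S] at h
    linarith
  -- Each cross term below contains a factor `Q` next to `σ`, so Cauchy-Schwarz makes it at most the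
  -- root of the lost trace `Tr QσQ ≤ δ`.
  have hbound {z : ℂ} {a : ℝ} (ha : a ≤ 1) (hz : ‖z‖ ^ 2 ≤ a * (Q * σ * Q).trace.re) :
      -z.re ≤ √δ := by
    refine (neg_le_abs _).trans ((Complex.abs_re_le_norm z).trans ?_)
    exact Real.le_sqrt_of_sq_le (hz.trans ((mul_le_of_le_one_left hQσ ha).trans (htrQ.trans_le hδ)))
  have hPσ1 : (P * σ * P).trace.re ≤ 1 := by linarith [htrQ]
  have hPSσ : ((P * S)ᴴ * σ * (P * S)).trace.re ≤ 1 := by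
    have h := re_trace_mul_nonneg hS1 (PosSemidef.sandwich hσ hP)
    rw [sub_mul, one_mul, Matrix.trace_sub, Complex.sub_re, mul_assoc S S, Matrix.trace_mul_comm S] at h
    have e : (P * S)ᴴ * σ * (P * S) = S * (P * σ * P) * S := by
      rw [Matrix.conjTranspose_mul, hP.eq, hS.eq]; simp only [mul_assoc]
    rw [e]; linarith
  have h1 := sq_norm_trace_mul_mul_le hσ S Q
  rw [hS.eq, hQh.eq] at h1
  have h2 := sq_norm_trace_mul_mul_le hσ Q (P * S)
  rw [hQh.eq, mul_comm (Q * σ * Q).trace.re] at h2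
  -- This is `σ - PσP = σQ + QσP`, tested against `S`.
  have e : (S * (P * σ * P - σ)).trace = -(S * σ * Q).trace - (Q * σ * (P * S)).trace := by
    have e1 : (Q * σ * (P * S)).trace = (S * (Q * σ * P)).trace := by
      rw [Matrix.trace_mul_comm S, mul_assoc, mul_assoc, mul_assoc]
    rw [e1, ← Matrix.trace_neg, ← Matrix.trace_sub, hQ]
    congr 1
    noncomm_ring
  rw [e, Complex.sub_re, Complex.neg_re]
  linarith [hbound hSσ h1, hbound hPSσ h2]

/-- If the pinched state `PσP` dominates `(1 - 2ε) PρP`, where `P` commutes with `ρ` and the traces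
are almost `1`, then `ρ` and `σ` are close in trace norm. -/
theorem traceNorm_sub_le {ρ σ P : Matrix ι ι ℂ} (hρ : ρ.PosSemidef) (hσ : σ.PosSemidef)
    (hρ1 : ρ.trace.re ≤ 1) (hσ1 : σ.trace.re ≤ 1) (hP : P.IsHermitian) (hPP : P * P = P)
    (hPρ : Commute P ρ) {ε τ τ₀ : ℝ} (hε : 0 ≤ ε) (hτ : 1 - τ ≤ ρ.trace.re)
    (hτ₀ : ρ.trace.re - (P * ρ * P).trace.re ≤ τ₀)
    (hdom : (P * σ * P - (1 - 2 * ε) • (P * ρ * P)).PosSemidef) :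
    traceNorm (ρ - σ) ≤ 4 * ε + τ + 2 * τ₀ + 2 * √(2 * ε + τ + τ₀) := by
  obtain ⟨S, hS, hS1, hS2, hS3, hSD⟩ := exists_traceNorm_eq_re_trace_mul (hρ.1.sub hσ.1)
  have hrest : (ρ - P * ρ * P).PosSemidef := by
    have e : ρ - P * ρ * P = (1 - P) * ρ * (1 - P) := by
      have h1 : P * ρ * P = P * ρ := by rw [mul_assoc, ← hPρ.eq, ← mul_assoc, hPP]
      rw [sub_mul, sub_mul, mul_sub, mul_sub, one_mul, mul_one, mul_one, h1, ← hPρ.eq]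
      simp
    rw [e]
    exact PosSemidef.sandwich hρ (Matrix.isHermitian_one.sub hP)
  have hA : (P * ρ * P).PosSemidef := PosSemidef.sandwich hρ hP
  have hA1 : (P * ρ * P).trace.re ≤ 1 := by
    have := re_trace_nonneg hrest
    rw [Matrix.trace_sub, Complex.sub_re] at this
    linarith
  have hσP : (P * σ * P).trace.re ≤ 1 := by
    have h := re_trace_mul_nonneg (posSemidef_of_isHermitian_of_idempotent
      (Matrix.isHermitian_one.sub hP) (by rw [sub_mul, one_mul, mul_sub, mul_one, hPP]; simp)) hσ
    rw [sub_mul, one_mul, Matrix.trace_sub, Complex.sub_re] at h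
    rw [Matrix.trace_mul_comm, ← mul_assoc, hPP]
    linarith
  have hdomtr := re_trace_nonneg hdom
  rw [Matrix.trace_sub, Complex.sub_re, re_trace_real_smul] at hdomtr
  have h1 := re_trace_mul_le_of_posSemidef hS1 hrest
  have h2 := re_trace_mul_le_of_posSemidef hS1 hA
  have h3 := neg_re_trace_mul_le_of_posSemidef hS2 hdom
  -- Domination gives `Tr PσP ≥ (1 - 2ε) Tr PρP`, with `1 - τ - τ₀ ≤ Tr PρP ≤ 1`; hence this `δ`.
  have h4 := re_trace_mul_pinch_sub_le hσ hσ1 hP hPP hS hS3 (δ := 2 * ε + τ + τ₀) (by nlinarith)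
  -- Except for the last one, handled by gentle measurement, every piece is a trace against a
  -- positive semidefinite matrix, so it is bounded by that matrix's trace.
  have e : S * (ρ - σ) = S * (ρ - P * ρ * P) + (2 * ε) • (S * (P * ρ * P))
      - S * (P * σ * P - (1 - 2 * ε) • (P * ρ * P)) + S * (P * σ * P - σ) := by
    simp only [mul_sub, Matrix.mul_smul, sub_smul, one_smul]
    abel
  rw [hSD, e, Matrix.trace_add, Matrix.trace_sub, Matrix.trace_add, Complex.add_re, Complex.sub_re,
    Complex.add_re, re_trace_real_smul]
  rw [Matrix.trace_sub, Complex.sub_re] at h1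
  rw [Matrix.trace_sub (P * σ * P), Complex.sub_re, re_trace_real_smul] at h3
  have h5 := mul_le_mul_of_nonneg_left h2 (by positivity : 0 ≤ 2 * ε)
  nlinarith

end TraceNorm

/-! ### Exponentials on the range of a projector. -/

section Exponential

variable {ι : Type*}

theorem isHermitian_real_smul {A : Matrix ι ι ℂ} (hA : A.IsHermitian) (r : ℝ) :
    (r • A).IsHermitian := by
  rw [Matrix.IsHermitian, Matrix.conjTranspose_smul, hA.eq, star_trivial]

variable [Fintype ι] [DecidableEq ι]

open scoped Matrix.Norms.L2Operator in
-- The power series acts termwise on `V`. It serves for `V = 1 - P` with `c = 0`, and for a rank-one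
-- eigenprojector.
theorem exp_mul_of_mul_eq_smul {H V : Matrix ι ι ℂ} {c : ℂ} (h : H * V = c • V) :
    NormedSpace.exp H * V = Complex.exp c • V := by
  have hpow (n : ℕ) : H ^ n * V = c ^ n • V := by
    induction n with
    | zero => simp
    | succ n ih => rw [pow_succ, mul_assoc, h, Matrix.mul_smul, ih, smul_smul, pow_succ']
  have h1 := (NormedSpace.exp_series_hasSum_exp' (𝕂 := ℂ) H).mul_right V
  have h2 := (NormedSpace.exp_series_hasSum_exp' (𝕂 := ℂ) c).smul_const V
  rw [← Complex.exp_eq_exp_ℂ] at h2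
  refine h1.unique ?_
  have h3 : (fun n : ℕ => ((n.factorial : ℂ)⁻¹ • c ^ n) • V) =
      fun n : ℕ => (n.factorial : ℂ)⁻¹ • H ^ n * V := by
    funext n
    rw [Matrix.smul_mul, hpow, smul_assoc]
  rw [← h3]
  exact h2

open scoped Matrix.Norms.L2Operator in
theorem exp_eq_cfc {H : Matrix ι ι ℂ} (hH : H.IsHermitian) :
    NormedSpace.exp H = cfc Real.exp H :=
  (CFC.real_exp_eq_normedSpace_exp hH.isSelfAdjoint).symm

theorem posSemidef_exp {H : Matrix ι ι ℂ} (hH : H.IsHermitian) :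
    (NormedSpace.exp H).PosSemidef := by
  rw [exp_eq_cfc hH]
  exact posSemidef_cfc fun t _ => (Real.exp_pos t).le

theorem re_trace_exp_add_le {H K : Matrix ι ι ℂ} (hH : H.IsHermitian) (hK : K.IsHermitian) :
    (NormedSpace.exp (H + K)).trace.re ≤ (NormedSpace.exp H * NormedSpace.exp K).trace.re := by
  rw [← norm_eq_re_of_nonneg (trace_mul_nonneg (posSemidef_exp hH) (posSemidef_exp hK))]
  exact (Complex.re_le_norm _).trans (norm_trace_exp_add_le hH hK)

theorem exp_mul_one_sub {H P : Matrix ι ι ℂ} (h : H * P = H) :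
    NormedSpace.exp H * (1 - P) = 1 - P := by
  have h0 : H * (1 - P) = (0 : ℂ) • (1 - P) := by rw [mul_sub, mul_one, h, sub_self, zero_smul]
  simpa using exp_mul_of_mul_eq_smul h0

/-- The Golden-Thompson inequality on the range of a projector `P`. -/
theorem re_trace_proj_mul_exp_add_le {H K P : Matrix ι ι ℂ} (hH : H.IsHermitian)
    (hK : K.IsHermitian) (hHP : H * P = H) (hKP : K * P = K) :
    (P * NormedSpace.exp (H + K)).trace.re ≤
      (P * NormedSpace.exp H * NormedSpace.exp K).trace.re := by
  have h := re_trace_exp_add_le hH hK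
  -- Off the range of `P` all exponentials are the identity, so both sides of Golden-Thompson
  -- contain the same summand `Tr (1 - P)`, which cancels.
  have e1 : NormedSpace.exp (H + K) = NormedSpace.exp (H + K) * P + (1 - P) := by
    rw [← exp_mul_one_sub (H := H + K) (P := P) (by rw [add_mul, hHP, hKP])]
    noncomm_ring
  have e2 : NormedSpace.exp H * NormedSpace.exp K =
      NormedSpace.exp H * NormedSpace.exp K * P + (1 - P) := by
    have h1 : NormedSpace.exp H * NormedSpace.exp K * (1 - P) = 1 - P := by
      rw [mul_assoc, exp_mul_one_sub hKP, exp_mul_one_sub hHP]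
    rw [← h1]
    noncomm_ring
  rw [e1, e2, Matrix.trace_add, Matrix.trace_add, Complex.add_re, Complex.add_re] at h
  rw [Matrix.trace_mul_comm P, mul_assoc P, Matrix.trace_mul_comm P]
  linarith

/-- The chord bound `exp(-ε M) ≤ 1 - (1 - e^{-ε}) M` for `0 ≤ M ≤ 1`. -/
theorem posSemidef_chord_sub_exp {M : Matrix ι ι ℂ} (hM : M.PosSemidef) (hM1 : (1 - M).PosSemidef)
    (ε : ℝ) :
    (1 - (1 - Real.exp (-ε)) • M - NormedSpace.exp (-(ε • M))).PosSemidef := by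
  have he : NormedSpace.exp (-(ε • M)) = cfc (fun t => Real.exp (-ε * t)) M := by
    rw [exp_eq_cfc (isHermitian_real_smul hM.1 ε).neg, ← neg_smul]
    exact (cfc_comp_const_mul (-ε) Real.exp M (Real.continuous_exp.continuousOn)
      hM.1.isSelfAdjoint).symm
  have hle : ∀ t ∈ spectrum ℝ M, t ≤ 1 :=
    (posSemidef_smul_one_sub_iff hM.1).mp (by rwa [one_smul])
  have hs : (1 - Real.exp (-ε)) • M = cfc (fun t => (1 - Real.exp (-ε)) * t) M := by
    rw [← smul_cfc, ← eq_cfc_id hM.1]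
  rw [he, hs, one_eq_cfc hM.1, cfc_sub_cfc, cfc_sub_cfc]
  refine posSemidef_cfc fun t ht => ?_
  have h := convexOn_exp.2 (Set.mem_univ (-ε)) (Set.mem_univ 0) (spectrum_nonneg hM ht)
    (sub_nonneg.mpr (hle t ht)) (by ring)
  simp only [smul_eq_mul, mul_zero, add_zero, Real.exp_zero, mul_one] at h
  rw [show -ε * t = t * -ε by ring]
  linarith

/-- Taking adjoints in `H P = H` shows that `P` commutes with `H`, so `P exp H = P exp(H) P`. -/
theorem posSemidef_proj_mul_exp {H P : Matrix ι ι ℂ} (hH : H.IsHermitian) (hP : P.IsHermitian)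
    (hPP : P * P = P) (hHP : H * P = H) : (P * NormedSpace.exp H).PosSemidef := by
  have hc : Commute P H := by
    have h := congrArg Matrix.conjTranspose hHP
    rw [Matrix.conjTranspose_mul, hH.eq, hP.eq] at h
    rw [Commute, SemiconjBy, h, hHP]
  have e : P * NormedSpace.exp H = P * NormedSpace.exp H * P := by
    rw [mul_assoc, ← hc.exp_right.eq, ← mul_assoc, hPP]
  rw [e]
  exact PosSemidef.sandwich (posSemidef_exp hH) hP

/-- One round of the multiplicative update decreases the potential `Tr P exp(H)`. -/
theorem re_trace_proj_mul_exp_update_le {H M P : Matrix ι ι ℂ} (hH : H.IsHermitian)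
    (hM : M.PosSemidef) (hM1 : (1 - M).PosSemidef) (hP : P.IsHermitian) (hPP : P * P = P)
    (hHP : H * P = H) (hMP : M * P = M) (ε : ℝ) :
    (P * NormedSpace.exp (H + -(ε • M))).trace.re ≤ (P * NormedSpace.exp H).trace.re
      - (1 - Real.exp (-ε)) * (P * NormedSpace.exp H * M).trace.re := by
  have h1 := re_trace_proj_mul_exp_add_le hH (isHermitian_real_smul hM.1 ε).neg hHP
    (by rw [neg_mul, Matrix.smul_mul, hMP])
  have h2 := re_trace_mul_nonneg (posSemidef_proj_mul_exp hH hP hPP hHP)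
    (posSemidef_chord_sub_exp hM hM1 ε)
  rw [mul_sub, mul_sub, mul_one, Matrix.mul_smul, Matrix.trace_sub, Matrix.trace_sub,
    Complex.sub_re, Complex.sub_re, re_trace_real_smul] at h2
  linarith

/-- A bound on `Tr P exp(-ε S)` bounds the spectrum of `S` on the range of `P` from below. -/
theorem posSemidef_sub_smul_of_re_trace_exp_le {S P : Matrix ι ι ℂ} (hS : S.IsHermitian)
    (hP : P.IsHermitian) (hPP : P * P = P) (hSP : S * P = S) {ε r : ℝ} (hε : 0 < ε)
    (h : (P * NormedSpace.exp (-(ε • S))).trace.re ≤ Real.exp (-(ε * r))) :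
    (S - r • P).PosSemidef := by
  have hPS : P * S = S := by
    have h := congrArg Matrix.conjTranspose hSP
    rwa [Matrix.conjTranspose_mul, hS.eq, hP.eq] at h
  have hW : (S - r • P).IsHermitian := hS.sub (isHermitian_real_smul hP r)
  rw [hW.posSemidef_iff_eigenvalues_nonneg]
  intro i
  by_contra! hi
  set μ := hW.eigenvalues i
  set v : ι → ℂ := (hW.eigenvectorBasis i).ofLp
  have hμ : μ < 0 := hi
  have hv : (S - r • P) *ᵥ v = μ • v := hW.mulVec_eigenvectorBasis i
  have hvv : star v ⬝ᵥ v = 1 := by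
    have h1 := hW.eigenvectorBasis.orthonormal.1 i
    have h2 := inner_self_eq_norm_sq_to_K (𝕜 := ℂ) (hW.eigenvectorBasis i)
    rw [h1, EuclideanSpace.inner_eq_star_dotProduct, dotProduct_comm] at h2
    simpa using h2
  -- The eigenvalue is nonzero and the matrix maps into the range of `P`, so `v` lies there.
  have hPv : P *ᵥ v = v := by
    have h1 : P *ᵥ (μ • v) = μ • v := by
      rw [← hv, Matrix.mulVec_mulVec, mul_sub, hPS, Matrix.mul_smul, hPP]
    rw [Matrix.mulVec_smul] at h1
    exact smul_right_injective _ hμ.ne h1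
  have hSv : S *ᵥ v = (μ + r) • v := by
    rw [Matrix.sub_mulVec, Matrix.smul_mulVec, hPv, sub_eq_iff_eq_add] at hv
    rw [hv, add_smul]
  set V := Matrix.vecMulVec v (star v)
  have hVh : V.IsHermitian := by
    simp [V, Matrix.IsHermitian, Matrix.conjTranspose_vecMulVec]
  have hVV : V * V = V := by
    simp [V, Matrix.vecMulVec_mul_vecMulVec, hvv]
  have hV1 : (1 - V).PosSemidef := posSemidef_of_isHermitian_of_idempotent
    (Matrix.isHermitian_one.sub hVh) (by rw [sub_mul, one_mul, mul_sub, mul_one, hVV]; simp)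
  have hVtr : V.trace = 1 := by
    rw [Matrix.trace_vecMulVec, dotProduct_comm, hvv]
  have hHV : -(ε • S) * V = ((-(ε * (μ + r)) : ℝ) : ℂ) • V := by
    rw [neg_mul, Matrix.smul_mul, Matrix.mul_vecMulVec, hSv, Matrix.smul_vecMulVec, smul_smul,
      ← neg_smul, ← Complex.coe_smul]
  have hG := posSemidef_proj_mul_exp (isHermitian_real_smul hS ε).neg hP hPP
    (by rw [neg_mul, Matrix.smul_mul, hSP])
  have hPV : P * V = V := by rw [Matrix.mul_vecMulVec, hPv]
  -- The direction `v` alone contributes `exp(-ε(μ + r))` to the trace, too much when `μ < 0`.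
  have h3 := re_trace_mul_nonneg hG hV1
  rw [mul_sub, mul_one, Matrix.trace_sub, Complex.sub_re, mul_assoc, exp_mul_of_mul_eq_smul hHV,
    Matrix.mul_smul, hPV, Matrix.trace_smul, hVtr, smul_eq_mul, mul_one, ← Complex.ofReal_exp,
    Complex.ofReal_re] at h3
  have h4 := Real.exp_le_exp.mp ((sub_nonneg.mp h3).trans h)
  nlinarith

end Exponential

/-! ### Regret bound and existence of runs. -/

section Run

variable {ι X : Type*} [Fintype ι] [DecidableEq ι]

theorem IsMMWURun.re_trace_weight_mul_le {L : ℕ} {P : Matrix ι ι ℂ} {ε : ℝ} {M : X → Matrix ι ι ℂ}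
    {x : Fin L → X} (hx : IsMMWURun P ε M x) {l : Fin L} (hG : (weight P ε M x l).PosSemidef)
    (y : X) : (weight P ε M x l * M y).trace.re ≤ (weight P ε M x l * M (x l)).trace.re := by
  have h := hx l y
  obtain ⟨h0, him⟩ := Complex.nonneg_iff.mp hG.trace_nonneg
  have hre : (weight P ε M x l).trace = (((weight P ε M x l).trace.re : ℝ) : ℂ) :=
    Complex.ext rfl (by simpa using him.symm)
  rcases h0.eq_or_lt with h0 | h0
  -- A positive semidefinite weight of zero trace vanishes, so both sides are `0`.
  · have : weight P ε M x l = 0 := by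
      rw [← hG.trace_eq_zero_iff, hre, ← h0, Complex.ofReal_zero]
    simp [this]
  · rw [mixedState, hre, ← Complex.ofReal_inv, Complex.coe_smul, Matrix.smul_mul, Matrix.smul_mul,
      re_trace_real_smul, re_trace_real_smul] at h
    exact le_of_mul_le_mul_left h (inv_pos.mpr h0)

/-- The regret bound of the matrix multiplicative weight update algorithm: if the average cost is
`c P`, then after `L` rounds the accumulated cost is at least `(1 - 2ε) L c P`. -/
theorem IsMMWURun.posSemidef_sum_sub [Fintype X] {L : ℕ} {P : Matrix ι ι ℂ} {ε : ℝ}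
    {M : X → Matrix ι ι ℂ} {x : Fin L → X} (hx : IsMMWURun P ε M x) {p : X → ℝ}
    (hp : p ∈ stdSimplex ℝ X) (hP : P.IsHermitian) (hPP : P * P = P) (hε : 0 < ε) (hε1 : ε ≤ 1)
    (hM : ∀ y, (M y).PosSemidef) (hM1 : ∀ y, (1 - M y).PosSemidef) (hMP : ∀ y, M y * P = M y)
    {c : ℝ} (hc : 0 ≤ c) (hsum : ∑ y, p y • M y = c • P)
    (hL : Real.log (Fintype.card ι) ≤ ε ^ 2 * (L * c)) :
    (∑ l, M (x l) - ((1 - 2 * ε) * (L * c)) • P).PosSemidef := by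
  have hherm (s : Finset (Fin L)) : (∑ l ∈ s, M (x l)).IsHermitian :=
    (Matrix.posSemidef_sum s fun l _ => hM (x l)).1
  have hsP (s : Finset (Fin L)) : (∑ l ∈ s, M (x l)) * P = ∑ l ∈ s, M (x l) := by
    rw [Finset.sum_mul]
    exact Finset.sum_congr rfl fun l _ => hMP _
  have hH (s : Finset (Fin L)) : (-(ε • ∑ l ∈ s, M (x l))).IsHermitian :=
    (isHermitian_real_smul (hherm s) ε).neg
  have hHP (s : Finset (Fin L)) : -(ε • ∑ l ∈ s, M (x l)) * P = -(ε • ∑ l ∈ s, M (x l)) := by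
    rw [neg_mul, Matrix.smul_mul, hsP]
  have hstep (l : Fin L) :
      (P * NormedSpace.exp (-(ε • ∑ l' ∈ Finset.Iic l, M (x l')))).trace.re ≤
        (P * NormedSpace.exp (-(ε • ∑ l' ∈ Finset.Iio l, M (x l')))).trace.re *
          Real.exp (-((1 - Real.exp (-ε)) * c)) := by
    have hG := posSemidef_proj_mul_exp (hH (Finset.Iio l)) hP hPP (hHP _)
    have h1 := re_trace_proj_mul_exp_update_le (hH (Finset.Iio l)) (hM (x l)) (hM1 (x l)) hP hPP
      (hHP _) (hMP _) ε
    rw [← neg_add, ← smul_add, add_comm (∑ l' ∈ Finset.Iio l, M (x l')),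
      ← Finset.sum_insert (f := fun l' => M (x l')) (by simp), Finset.Iio_insert] at h1
    -- A maximum is at least the `p`-average, which `hsum` evaluates.
    have h2 : c * (P * NormedSpace.exp (-(ε • ∑ l' ∈ Finset.Iio l, M (x l')))).trace.re ≤
        (P * NormedSpace.exp (-(ε • ∑ l' ∈ Finset.Iio l, M (x l'))) * M (x l)).trace.re := by
      have h3 := Finset.sum_le_sum fun y (_ : y ∈ Finset.univ) =>
        mul_le_mul_of_nonneg_left (hx.re_trace_weight_mul_le (l := l) hG y) (hp.1 y)
      rw [← Finset.sum_mul, hp.2, one_mul] at h3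
      have e : ∑ y, p y * (weight P ε M x l * M y).trace.re =
          c * (weight P ε M x l).trace.re := by
        simp only [← re_trace_real_smul, ← Matrix.mul_smul]
        rw [← Complex.re_sum, ← Matrix.trace_sum, ← Finset.mul_sum, hsum, Matrix.mul_smul,
          re_trace_real_smul, re_trace_real_smul, Matrix.trace_mul_comm _ P, weight, ← mul_assoc,
          hPP]
      rw [e] at h3
      exact h3
    have h4 : 0 ≤ 1 - Real.exp (-ε) := by
      rw [sub_nonneg, Real.exp_le_one_iff]; linarith
    have h5 := Real.add_one_le_exp (-((1 - Real.exp (-ε)) * c))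
    have h6 := mul_le_mul_of_nonneg_left h5 (re_trace_nonneg hG)
    have h7 := mul_le_mul_of_nonneg_left h2 h4
    linarith
  have hpot (k : ℕ) (hk : k ≤ L) :
      (P * NormedSpace.exp (-(ε • ∑ l with l.val < k, M (x l)))).trace.re ≤
        P.trace.re * Real.exp (-((1 - Real.exp (-ε)) * c)) ^ k := by
    induction k with
    | zero => simp
    | succ k ih =>
      have h1 := hstep ⟨k, hk⟩
      have e1 : Finset.Iic (⟨k, hk⟩ : Fin L) = Finset.univ.filter fun l => l.val < k + 1 := by
        ext l; simp [Fin.le_def]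
      have e2 : Finset.Iio (⟨k, hk⟩ : Fin L) = Finset.univ.filter fun l => l.val < k := by
        ext l; simp [Fin.lt_def]
      rw [e1, e2] at h1
      refine h1.trans ?_
      rw [pow_succ, ← mul_assoc]
      exact mul_le_mul_of_nonneg_right (ih (by omega)) (Real.exp_pos _).le
  have hfin := hpot L le_rfl
  rw [Finset.filter_true_of_mem fun l _ => l.2, ← Real.exp_nat_mul] at hfin
  refine posSemidef_sub_smul_of_re_trace_exp_le (hherm _) hP hPP (hsP _) hε (hfin.trans ?_)
  have htr : P.trace.re ≤ Fintype.card ι := by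
    have h := re_trace_nonneg (posSemidef_of_isHermitian_of_idempotent
      (Matrix.isHermitian_one.sub hP) (by rw [sub_mul, one_mul, mul_sub, mul_one, hPP]; simp))
    rw [Matrix.trace_sub, Complex.sub_re, Matrix.trace_one, Complex.natCast_re] at h
    linarith
  have hcard : (Fintype.card ι : ℝ) ≤ Real.exp (ε ^ 2 * (L * c)) := by
    rcases Nat.eq_zero_or_pos (Fintype.card ι) with h | h
    · rw [h]; simpa using (Real.exp_pos _).le
    · exact (Real.log_le_iff_le_exp (by exact_mod_cast h)).mp hL
  -- This quadratic error costs one `ε` in the factor `1 - 2ε`; the bound on `ln dim` costs the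
  -- other.
  have hexp : Real.exp (-ε) ≤ 1 - ε + ε ^ 2 := by
    have := Real.abs_exp_sub_one_sub_id_le (x := -ε) (by rw [abs_neg, abs_of_pos hε]; exact hε1)
    have := (abs_le.mp this).2
    linarith [neg_sq ε]
  calc P.trace.re * Real.exp (L * -((1 - Real.exp (-ε)) * c))
      ≤ Real.exp (ε ^ 2 * (L * c)) * Real.exp (L * -((1 - Real.exp (-ε)) * c)) := by
        gcongr
        exact htr.trans hcard
    _ ≤ _ := by
        rw [← Real.exp_add, Real.exp_le_exp]
        have : 0 ≤ L * c := by positivity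
        nlinarith

/-- Round `l` depends only on earlier choices, so maximizers can be picked recursively; `x₀` is an
irrelevant filler for the remaining entries. -/
theorem exists_isMMWURun [Finite X] [Nonempty X] (L : ℕ) (P : Matrix ι ι ℂ) (ε : ℝ)
    (M : X → Matrix ι ι ℂ) : ∃ x : Fin L → X, IsMMWURun P ε M x := by
  have hmax (l : Fin L) (x : Fin L → X) : ∃ z, ∀ y,
      (mixedState P ε M x l * M y).trace.re ≤ (mixedState P ε M x l * M z).trace.re :=
    Finite.exists_max _
  choose f hf using hmax
  obtain ⟨x₀⟩ := ‹Nonempty X›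
  let x : Fin L → X := (wellFounded_lt (α := Fin L)).fix fun l ih =>
    f l fun j => if h : j < l then ih j h else x₀
  have hx (l : Fin L) : x l = f l fun j => if j < l then x j else x₀ := by
    have := (wellFounded_lt (α := Fin L)).fix_eq (fun l ih =>
      f l fun j => if h : j < l then ih j h else x₀) l
    simpa [x] using this
  refine ⟨x, fun l y => ?_⟩
  have hw : mixedState P ε M (fun j => if j < l then x j else x₀) l = mixedState P ε M x l := by
    have : ∑ l' ∈ Finset.Iio l, M (if l' < l then x l' else x₀) =
        ∑ l' ∈ Finset.Iio l, M (x l') :=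
      Finset.sum_congr rfl fun j hj => by rw [if_pos (Finset.mem_Iio.mp hj)]
    simp only [mixedState, weight, this]
  have h := hf l (fun j => if j < l then x j else x₀) y
  rwa [hw, ← hx l] at h

end Run

/-! ### Spectral truncation of `E_p`. -/

section Truncation

variable {ι : Type*} [Fintype ι] [DecidableEq ι]

/-- Expressing everything as a function of `ρ` reduces the later matrix identities to scalar ones.
-/
theorem pinch_projGT {ρ : Matrix ι ι ℂ} (hρ : ρ.IsHermitian) (c : ℝ) :
    pinch (projGT ρ c) ρ = cfc (fun t : ℝ => if c < t then t else 0) ρ := by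
  have h : pinch (projGT ρ c) ρ = projGT ρ c * cfc (fun t : ℝ => t) ρ * projGT ρ c := by
    rw [pinch, ← eq_cfc_id hρ]
  rw [h, projGT, cfc_mul_cfc, cfc_mul_cfc]
  congr 1
  funext t
  split_ifs <;> simp

/-- For `c > 0` no retained eigenvalue becomes `0`, so the algorithm's space, the support of the
pinched `ρ`, is the range of the original projector. -/
theorem projGT_pinch_projGT {ρ : Matrix ι ι ℂ} (hρ : ρ.IsHermitian) {c : ℝ} (hc : 0 < c) :
    projGT (pinch (projGT ρ c) ρ) 0 = projGT ρ c := by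
  rw [pinch_projGT hρ, projGT, cfc_cfc _ _ hρ, projGT]
  congr 1
  funext t
  by_cases h : c < t
  · simp [h, hc.trans h]
  · simp [h]

theorem invSqrt_pinch_projGT {ρ : Matrix ι ι ℂ} (hρ : ρ.IsHermitian) (c : ℝ) :
    invSqrt (pinch (projGT ρ c) ρ) = cfc (fun t : ℝ => if c < t then (√t)⁻¹ else 0) ρ := by
  rw [pinch_projGT hρ, invSqrt, cfc_cfc _ _ hρ]
  congr 1
  funext t
  split_ifs <;> simp

theorem isHermitian_projGT (ρ : Matrix ι ι ℂ) (c : ℝ) : (projGT ρ c).IsHermitian :=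
  isHermitian_cfc _ _

theorem projGT_mul_projGT (ρ : Matrix ι ι ℂ) (c : ℝ) : projGT ρ c * projGT ρ c = projGT ρ c := by
  rw [projGT, cfc_mul_cfc]
  congr 1
  funext t
  split_ifs <;> simp

theorem commute_projGT {ρ : Matrix ι ι ℂ} (hρ : ρ.IsHermitian) (c : ℝ) :
    Commute (projGT ρ c) ρ := by
  have h := cfc_commute_cfc (fun t : ℝ => if c < t then (1 : ℝ) else 0) (fun t : ℝ => t) ρ
  rwa [← eq_cfc_id hρ] at h

/-- Each discarded eigenvalue is at most `c`, and there are at most `dim V` of them. -/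
theorem re_trace_sub_pinch_le {ρ : Matrix ι ι ℂ} (hρ : ρ.IsHermitian) {c : ℝ} (hc : 0 ≤ c) :
    ρ.trace.re - (pinch (projGT ρ c) ρ).trace.re ≤ c * Fintype.card ι := by
  have h : (c • (1 : Matrix ι ι ℂ) - (ρ - pinch (projGT ρ c) ρ)).PosSemidef := by
    have e : ρ - pinch (projGT ρ c) ρ = cfc (fun t : ℝ => t - if c < t then t else 0) ρ := by
      rw [pinch_projGT hρ, ← cfc_sub_cfc, ← eq_cfc_id hρ]
    rw [e, one_eq_cfc hρ, smul_cfc, cfc_sub_cfc]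
    refine posSemidef_cfc fun t _ => ?_
    split_ifs with h
    · simpa using hc
    · simpa using h
  have h' := re_trace_nonneg h
  rw [Matrix.trace_sub, Matrix.trace_sub, Complex.sub_re, Complex.sub_re, re_trace_real_smul,
    Matrix.trace_one, Complex.natCast_re] at h'
  linarith

end Truncation

/-! ### Positivity and traces of averages. -/

section Average

variable {ι X : Type*}

theorem posSemidef_avg [Fintype X] {p : X → ℝ} (hp : ∀ y, 0 ≤ p y) {E : X → Matrix ι ι ℂ}
    (hE : ∀ y, (E y).PosSemidef) : (avg p E).PosSemidef :=
  Matrix.posSemidef_sum _ fun y _ => (hE y).smul (hp y)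

theorem posSemidef_codebookAvg {L : ℕ} {E : X → Matrix ι ι ℂ} (hE : ∀ y, (E y).PosSemidef)
    (x : Fin L → X) : (codebookAvg E x).PosSemidef :=
  (Matrix.posSemidef_sum _ fun l _ => hE (x l)).smul (by positivity : (0 : ℝ) ≤ 1 / L)

variable [Fintype ι]

theorem re_trace_avg_le_one [Fintype X] {p : X → ℝ} (hp : p ∈ stdSimplex ℝ X)
    {E : X → Matrix ι ι ℂ} (hE : ∀ y, (E y).trace.re ≤ 1) : (avg p E).trace.re ≤ 1 := by
  rw [avg, Matrix.trace_sum, Complex.re_sum, ← hp.2]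
  refine Finset.sum_le_sum fun y _ => ?_
  rw [re_trace_real_smul]
  exact mul_le_of_le_one_right (hp.1 y) (hE y)

theorem re_trace_codebookAvg_le_one {L : ℕ} {E : X → Matrix ι ι ℂ}
    (hE : ∀ y, (E y).trace.re ≤ 1) (x : Fin L → X) : (codebookAvg E x).trace.re ≤ 1 := by
  rw [codebookAvg, re_trace_real_smul, Matrix.trace_sum, Complex.re_sum, one_div_mul_eq_div]
  refine div_le_one_of_le₀ ?_ (Nat.cast_nonneg L)
  simpa using Finset.sum_le_sum fun l (_ : l ∈ Finset.univ) => hE (x l)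

end Average

/-! ### From regret to domination by the codebook average. -/

section CostMatrix

variable {ι X : Type*} [Fintype ι] [DecidableEq ι]

theorem posSemidef_lambdaMax_smul_one_sub {A : Matrix ι ι ℂ} (hA : A.IsHermitian) :
    (lambdaMax A • (1 : Matrix ι ι ℂ) - A).PosSemidef :=
  (posSemidef_smul_one_sub_iff hA).mpr fun _ ht =>
    le_csSup Matrix.finite_real_spectrum.bddAbove ht

/-- The condition `0 ≤ r` covers an empty spectrum, whose `sSup` is `0` by default. -/
theorem lambdaMax_le {A : Matrix ι ι ℂ} (hA : A.IsHermitian) {r : ℝ} (hr : 0 ≤ r)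
    (h : (r • (1 : Matrix ι ι ℂ) - A).PosSemidef) : lambdaMax A ≤ r :=
  Real.sSup_le ((posSemidef_smul_one_sub_iff hA).mp h) hr

/-- The covering property of the codebooks found by the algorithm: on the range of the spectral
projector `P` of `E_p`, the codebook average dominates `(1 - 2ε) E_p`. -/
theorem posSemidef_pinch_codebookAvg_sub [Fintype X] {p : X → ℝ} (hp : p ∈ stdSimplex ℝ X)
    {E : X → Matrix ι ι ℂ} (hE : ∀ y, (E y).PosSemidef) {ε η c : ℝ} (hε : 0 < ε) (hε1 : ε ≤ 1)
    (hc : 0 < c) (hη : 0 ≤ η) (hEη : ∀ y, (η • (1 : Matrix ι ι ℂ) - E y).PosSemidef)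
    (hA : 0 < (pinch (projGT (avg p E) c) (avg p E)).trace.re) {L : ℕ} (hL0 : 0 < L)
    (hL : η / c * Real.log (Fintype.card ι) ≤ ε ^ 2 * L) {x : Fin L → X}
    (hx : IsMMWURun (projGT (pinch (projGT (avg p E) c) (avg p E)) 0) ε
      (costMatrix (pinch (projGT (avg p E) c) (avg p E)) fun y => pinch (projGT (avg p E) c) (E y))
      x) :
    (pinch (projGT (avg p E) c) (codebookAvg E x) -
      (1 - 2 * ε) • pinch (projGT (avg p E) c) (avg p E)).PosSemidef := by
  have hρ : (avg p E).IsHermitian := (posSemidef_avg hp.1 hE).1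
  rw [projGT_pinch_projGT hρ hc] at hx
  set ρ := avg p E with hρdef
  set P := projGT ρ c with hPdef
  set A := pinch P ρ with hAdef
  set N := invSqrt A with hNdef
  have hN : N = cfc (fun t : ℝ => if c < t then (√t)⁻¹ else 0) ρ := invSqrt_pinch_projGT hρ c
  -- `R` is the square root of `A`, inverse to `N` on the range of `P`; it will undo the
  -- normalization of the costs.
  set R := cfc (fun t : ℝ => if c < t then √t else 0) ρ with hRdef
  have hNh : N.IsHermitian := isHermitian_cfc _ _
  have hRh : R.IsHermitian := isHermitian_cfc _ _
  have hPh : P.IsHermitian := isHermitian_projGT ρ c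
  have hPP : P * P = P := projGT_mul_projGT ρ c
  have hPpsd : P.PosSemidef := posSemidef_of_isHermitian_of_idempotent hPh hPP
  have hsqrt {t : ℝ} (ht : c < t) : √t ≠ 0 := (Real.sqrt_pos.mpr (hc.trans ht)).ne'
  have hNP : N * P = N := by
    rw [hN, hPdef, projGT, cfc_mul_cfc]
    congr 1; funext t; split_ifs <;> simp
  have hPN : P * N = N := by
    rw [hN, hPdef, projGT, cfc_mul_cfc]
    congr 1; funext t; split_ifs <;> simp
  have hRP : R * P = R := by
    rw [hRdef, hPdef, projGT, cfc_mul_cfc]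
    congr 1; funext t; split_ifs <;> simp
  have hRN : R * N = P := by
    rw [hN, hRdef, hPdef, projGT, cfc_mul_cfc]
    congr 1; funext t
    split_ifs with h
    · exact mul_inv_cancel₀ (hsqrt h)
    · simp
  have hNR : N * R = P := by
    rw [hN, hRdef, hPdef, projGT, cfc_mul_cfc]
    congr 1; funext t
    split_ifs with h
    · exact inv_mul_cancel₀ (hsqrt h)
    · simp
  have hRR : R * R = A := by
    rw [hAdef, hPdef, pinch_projGT hρ, hRdef, cfc_mul_cfc]
    congr 1; funext t
    split_ifs with h
    · exact Real.mul_self_sqrt (hc.trans h).le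
    · simp
  have hNN : ((1 / c) • (1 : Matrix ι ι ℂ) - N * N).PosSemidef := by
    rw [hN, cfc_mul_cfc, one_eq_cfc hρ, smul_cfc, cfc_sub_cfc]
    refine posSemidef_cfc fun t _ => ?_
    split_ifs with h
    · rw [← mul_inv, Real.mul_self_sqrt (hc.trans h).le, mul_one, sub_nonneg, one_div]
      exact inv_anti₀ hc h.le
    · simpa using hc.le
  set B : X → Matrix ι ι ℂ := fun y => N * pinch P (E y) * N with hB
  have hBpsd (y : X) : (B y).PosSemidef :=
    PosSemidef.sandwich (PosSemidef.sandwich (hE y) hPh) hNh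
  have hBP (y : X) : B y * P = B y := by rw [hB, mul_assoc, hNP]
  -- From `E y ≤ η` and `N² ≤ 1/c`; this is what bounds `Λ = e^{D_max}` by `η / c`.
  have hBle (y : X) : ((η / c) • (1 : Matrix ι ι ℂ) - B y).PosSemidef := by
    have h1 := (PosSemidef.sandwich (hEη y) hNh).add (hNN.smul hη)
    have e : N * (η • 1 - E y) * N + η • ((1 / c) • 1 - N * N) = (η / c) • 1 - B y := by
      have e1 : B y = N * E y * N := by
        simp only [hB, pinch, ← mul_assoc, hNP]
        rw [mul_assoc (N * E y), hPN]
      rw [e1, mul_sub, sub_mul, Matrix.mul_smul, Matrix.smul_mul, mul_one, smul_sub, smul_smul,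
        mul_one_div]
      abel
    rwa [e] at h1
  have hBsum : ∑ y, p y • B y = P := by
    have e : ∑ y, p y • B y = N * A * N := by
      simp only [hB, hAdef, hρdef, pinch, avg, Finset.mul_sum, Finset.sum_mul, Matrix.mul_smul,
        Matrix.smul_mul]
    rw [e, ← hRR, ← mul_assoc, hNR, mul_assoc, hRN, hPP]
  set Λ := ⨆ y, lambdaMax (B y) with hΛ
  have hΛle : Λ ≤ η / c :=
    Real.iSup_le (fun y => lambdaMax_le (hBpsd y).1 (by positivity) (hBle y)) (by positivity)
  have hBΛ (y : X) : (Λ • (1 : Matrix ι ι ℂ) - B y).PosSemidef := by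
    have h1 : 0 ≤ Λ - lambdaMax (B y) :=
      sub_nonneg.mpr (le_ciSup (Set.finite_range fun y => lambdaMax (B y)).bddAbove y)
    have h2 := (posSemidef_lambdaMax_smul_one_sub (hBpsd y).1).add
      (Matrix.PosSemidef.one.smul h1)
    rw [sub_smul] at h2
    convert h2 using 1
    abel
  have hPtr : 0 < P.trace.re := by
    refine (re_trace_nonneg hPpsd).lt_of_ne fun h0 => hA.ne' ?_
    have h1 : P.trace = 0 := Complex.ext h0.symm (Complex.nonneg_iff.mp hPpsd.trace_nonneg).2.symm
    rw [hAdef, pinch, hPpsd.trace_eq_zero_iff.mp h1]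
    simp
  -- Averaging `B y ≤ Λ` over `p` gives `P ≤ Λ`, and `Tr P > 0`. Positivity is what makes `exp (log
  -- Λ)` equal to `Λ`.
  have hΛ0 : 0 < Λ := by
    have h1 := re_trace_nonneg (posSemidef_avg hp.1 hBΛ)
    have e : avg p (fun y => Λ • (1 : Matrix ι ι ℂ) - B y) = Λ • 1 - P := by
      rw [avg, ← hBsum]
      simp only [smul_sub, Finset.sum_sub_distrib]
      rw [← Finset.sum_smul, hp.2, one_smul]
    rw [e, Matrix.trace_sub, Complex.sub_re, re_trace_real_smul, Matrix.trace_one,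
      Complex.natCast_re] at h1
    exact pos_of_mul_pos_left (hPtr.trans_le (sub_nonneg.mp h1)) (Nat.cast_nonneg _)
  have hcost (y : X) : costMatrix A (fun y => pinch P (E y)) y = Λ⁻¹ • B y := by
    rw [costMatrix, dMax, ← hNdef, ← hΛ, Real.exp_neg, Real.exp_log hΛ0]
  have hΛ' : 0 ≤ Λ⁻¹ := inv_nonneg.mpr hΛ0.le
  have hL0' : (0 : ℝ) < L := by exact_mod_cast hL0
  have hrun := hx.posSemidef_sum_sub hp hPh hPP hε hε1 (c := Λ⁻¹)
    (fun y => by rw [hcost]; exact (hBpsd y).smul hΛ')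
    (fun y => by
      have h1 := (hBΛ y).smul hΛ'
      rwa [smul_sub, smul_smul, inv_mul_cancel₀ hΛ0.ne', one_smul, ← hcost] at h1)
    (fun y => by rw [hcost, Matrix.smul_mul, hBP]) hΛ'
    (by
      simp only [hcost]
      rw [← hBsum, Finset.smul_sum]
      exact Finset.sum_congr rfl fun y _ => smul_comm _ _ _)
    (by
      rw [← mul_assoc, ← div_eq_mul_inv, le_div_iff₀ hΛ0, mul_comm]
      exact (mul_le_mul_of_nonneg_right hΛle (Real.log_natCast_nonneg _)).trans hL)
  -- Conjugation by `R` turns `B y` into the pinched edge and `P` into `A`; the factor `Λ / L`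
  -- restores the scale.
  have hfin := (PosSemidef.sandwich hrun hRh).smul (by positivity : 0 ≤ Λ / L)
  have hRB (y : X) : R * B y * R = pinch P (E y) := by
    rw [hB]
    simp only [← mul_assoc, hRN]
    rw [mul_assoc, hNR, pinch]
    simp only [← mul_assoc, hPP]
    rw [mul_assoc, hPP]
  convert hfin using 1
  rw [mul_sub, sub_mul, smul_sub, Matrix.mul_smul, Matrix.smul_mul, hRP, hRR, smul_smul]
  congr 1
  · simp only [hcost, Finset.mul_sum, Finset.sum_mul, Matrix.mul_smul, Matrix.smul_mul, hRB]
    simp only [codebookAvg, pinch, Matrix.mul_smul, Matrix.smul_mul, Finset.mul_sum, Finset.sum_mul]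
    rw [← Finset.smul_sum, smul_smul]
    congr 1
    field_simp
  · congr 1
    field_simp

end CostMatrix

end SoftCovering

end

/-! ### The main theorem. -/

open SoftCovering

theorem mainTheorem1 {ι X : Type*} [Fintype ι] [DecidableEq ι] [Fintype X]
    (p : X → ℝ) (hp : p ∈ stdSimplex ℝ X)
    (E : X → Matrix ι ι ℂ) (ε τ τ₀ η : ℝ)
    (hε : ε ∈ Set.Ioo (0 : ℝ) (1 / 2)) (hτ : τ ∈ Set.Ioo (0 : ℝ) (1 / 2))
    (hτ₀ : τ₀ ∈ Set.Ioo (0 : ℝ) (1 / 2 - τ)) (hη : 0 < η)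
    (hE : ∀ x, (E x).PosSemidef)
    (hE_trace : ∀ x, (E x).trace.re ≤ 1)
    (hE_le : ∀ x, (η • (1 : Matrix ι ι ℂ) - E x).PosSemidef)
    (hEp : 1 - τ ≤ (avg p E).trace.re)
    (L : ℕ) (hL_pos : 0 < L)
    (hL : η * Fintype.card ι * Real.log (Fintype.card ι) / (ε ^ 2 * τ₀) ≤ L) :
    (∃ x : Fin L → X, IsMMWUCodebook p E ε τ₀ x) ∧
      ∀ x : Fin L → X, IsMMWUCodebook p E ε τ₀ x →
        traceDist (avg p E) (codebookAvg E x) ≤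
          3 * ε + 3 * τ + 7 / 2 * τ₀ + Real.sqrt (2 * ε + τ + τ₀) := by
  obtain ⟨hε0, hε1⟩ := hε
  obtain ⟨hτ0, hτ1⟩ := hτ
  obtain ⟨hτ₀0, hτ₀1⟩ := hτ₀
  have hX : Nonempty X := by
    by_contra h
    rw [not_nonempty_iff] at h
    simpa using hp.2
  refine ⟨exists_isMMWURun L _ _ _, fun x hx => ?_⟩
  have hι : Nonempty ι := by
    by_contra h
    rw [not_nonempty_iff] at h
    simp [Matrix.trace] at hEp
    linarith
  have hn : (0 : ℝ) < Fintype.card ι := by exact_mod_cast Fintype.card_pos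
  have hc : 0 < τ₀ / Fintype.card ι := div_pos hτ₀0 hn
  have hρ := posSemidef_avg hp.1 hE
  have htail := re_trace_sub_pinch_le hρ.1 hc.le
  -- The threshold `τ₀ / dim V` makes the discarded trace at most `τ₀`; hence `Tr PρP ≥ 1 - τ - τ₀ >
  -- 0`, as needed for `hdom`.
  rw [div_mul_cancel₀ _ hn.ne'] at htail
  have hdom := posSemidef_pinch_codebookAvg_sub hp hE hε0 (by linarith) hc hη.le hE_le
    (by linarith) hL_pos (by
      rw [div_le_iff₀ (by positivity)] at hL
      rw [div_div_eq_mul_div, div_mul_eq_mul_div, div_le_iff₀ hτ₀0]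
      linarith) hx
  have h := traceNorm_sub_le hρ (posSemidef_codebookAvg hE x) (re_trace_avg_le_one hp hE_trace)
    (re_trace_codebookAvg_le_one hE_trace x) (isHermitian_projGT _ _) (projGT_mul_projGT _ _)
    (commute_projGT hρ.1 _) hε0.le hEp htail hdom
  -- Halving gives `2ε + τ/2 + τ₀ + √(2ε + τ + τ₀)`, which is stronger than the stated bound.
  rw [traceDist]
  linarith
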